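/- A finite simple graph $G=(V,E)$ is word-representable if there is a finite word $w$ over the alphabet $V$, containing every vertex at least once, such that for all distinct $a,b\in V$ we have $ab\in E$ if and only if $a$ and $b$ alternate in $w$, that is, after deleting all letters other than $a$ and $b$ from $w$ no two consecutive letters are equal. The line graph $L(G)$ has the edges of $G$ as vertices, two distinct edges being adjacent if and only if they share an endpoint. The Mycielski graph $\mu(G)$ of a graph $G$ has vertex set $V\cup\{v' : v\in V\}\cup\{0\}$ (a disjoint union) and edge set $E\cup\{0v' : v\in V\}\cup\{uv',\,vu' : uv\in E\}$. Let $C_m$ denote the cycle on $m$ vertices. **Theorem.** For every integer $n\ge 2$, the line graph $L(\mu(C_{2n+1}))$ is word-representable. -/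

import Mathlib

/-- Vertices of the Mycielski graph: the vertices `i` of the original graph, a copy `i'` of each,
and one extra vertex `0`. -/
inductive MycielskiVertex (V : Type*) where
  | orig : V → MycielskiVertex V
  | copy : V → MycielskiVertex V
  | apex : MycielskiVertex V

/-- The Mycielski graph `μ(G)`: the edges of `G`, an edge between `0` and every copy `i'`,
and the edges `i j'`, `j i'` for every edge `i j` of `G`. -/
def SimpleGraph.mycielski {V : Type*} (G : SimpleGraph V) : SimpleGraph (MycielskiVertex V) where
  Adj
    | .orig i, .orig j => G.Adj i j
    | .orig i, .copy j => G.Adj i j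
    | .copy i, .orig j => G.Adj i j
    | .copy _, .apex => True
    | .apex, .copy _ => True
    | _, _ => False
  symm := ⟨by
    rintro (i | i | _) (j | j | _) h <;> first | exact G.adj_symm h | exact h⟩
  loopless := ⟨by
    rintro (i | i | _) h
    · exact G.loopless.irrefl i h
    · exact h
    · exact h⟩

open Classical in
/-- Distinct letters `a` and `b` alternate in the word `w`: once all other letters are deleted,
no two consecutive letters of the remaining word are equal. -/
def Alternate {V : Type*} (w : List V) (a b : V) : Prop :=
  (w.filter (fun x => x = a ∨ x = b)).IsChain (· ≠ ·)

/-- The word `w` over the vertex set of `G` represents `G`: every vertex occurs in `w`, and two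
distinct vertices are adjacent if and only if they alternate in `w`. -/
def SimpleGraph.RepresentedBy {V : Type*} (G : SimpleGraph V) (w : List V) : Prop :=
  (∀ v, v ∈ w) ∧ ∀ a b, a ≠ b → (G.Adj a b ↔ Alternate w a b)

/-- `G` is word-representable: some (finite) word over its vertex set represents it. -/
def SimpleGraph.WordRepresentable {V : Type*} (G : SimpleGraph V) : Prop :=
  ∃ w : List V, G.RepresentedBy w

/-! ### Semi-transitive orientations and representing words -/

open Relation

/-! A semi-transitive orientation yields a representing word: concatenate, over all vertices `v`, a
word in which every arc `a → b` reads `abab` and `v` alternates only with its neighbours. In a line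
graph, an injective vertex label `f` orders the edges at each vertex by their far ends. Directed
paths then shorten to walks v₀v₁v₂… with f(vᵢ) < f(vᵢ₊₂), and the orientation is semi-transitive
once no such walk ends at v₀. For the Mycielski graph, a label growing along the odd cycle suffices.
A returning walk avoiding the apex at its last step would be trapped between two neighbouring
indices; one returning from the apex would need a label that does not exist. -/

/-- An orientation `R` is semi-transitive if it is acyclic and every vertex on a directed path
from `a` to `c` is joined to both ends as soon as `R a c` holds. -/
structure SemiTransitive {V : Type*} (R : V → V → Prop) : Prop where
  acyclic : ∀ a, ¬ TransGen R a a
  left : ∀ {a b c}, R a c → TransGen R a b → TransGen R b c → R a b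
  right : ∀ {a b c}, R a c → TransGen R a b → TransGen R b c → R b c

open Classical in
theorem exists_topological_list {V : Type*} [Finite V] {R : V → V → Prop}
    (h : ∀ a, ¬ TransGen R a a) :
    ∃ l : List V, (∀ v, v ∈ l) ∧
      (∀ a b, a ≠ b → l.filter (fun x => x = a ∨ x = b) = [a, b] ∨
        l.filter (fun x => x = a ∨ x = b) = [b, a]) ∧
      ∀ a b, R a b → l.filter (fun x => x = a ∨ x = b) = [a, b] := by
  have := Fintype.ofFinite V
  have hpo : IsPartialOrder V (ReflTransGen R) :=
    { refl := fun _ => .refl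
      trans := fun _ _ _ => ReflTransGen.trans
      antisymm := fun a b hab hba => by
        rcases reflTransGen_iff_eq_or_transGen.1 hab with rfl | hab'
        · rfl
        · exact absurd (hab'.trans_left hba) (h a) }
  obtain ⟨s, hs, hle⟩ := extend_partialOrder (ReflTransGen R)
  have hpair : ∀ a b, a ≠ b → s a b →
      (Finset.univ.sort s).filter (fun x => x = a ∨ x = b) = [a, b] := by
    intro a b hab hsab
    refine List.Perm.eq_of_pairwise (le := s) ?_ ?_ ?_ ?_
    · intro x y _ _ hxy hyx
      exact antisymm hxy hyx
    · exact (Finset.pairwise_sort _ s).filter _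
    · simpa using hsab
    · rw [List.perm_ext_iff_of_nodup ((Finset.sort_nodup _ s).filter _) (by simpa using hab)]
      simp
  refine ⟨Finset.univ.sort s, by simp, fun a b hab => ?_, fun a b hR => ?_⟩
  · rcases total_of s a b with hs | hs
    · exact .inl (hpair a b hab hs)
    · right
      rw [← hpair b a hab.symm hs]
      simp only [or_comm]
  · refine hpair a b ?_ (hle _ _ (.single hR))
    rintro rfl
    exact h a (.single hR)

/-- The position of a vertex relative to a fixed vertex of an oriented graph. -/
inductive RelPos where
  | self | inNbr | outNbr | ancestor | descendant | unrelated

open Classical in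
noncomputable def relPos {V : Type*} (R : V → V → Prop) (v u : V) : RelPos :=
  if u = v then .self else if R u v then .inNbr else if R v u then .outNbr
  else if TransGen R u v then .ancestor else if TransGen R v u then .descendant else .unrelated

theorem relPos_cases {V : Type*} (R : V → V → Prop) {v u : V} (h : u ≠ v) :
    relPos R v u = .inNbr ∧ R u v ∨ relPos R v u = .outNbr ∧ R v u ∨
      relPos R v u = .ancestor ∧ ¬ R u v ∧ TransGen R u v ∨
      relPos R v u = .descendant ∧ ¬ R v u ∧ TransGen R v u ∨
      relPos R v u = .unrelated ∧ ¬ TransGen R u v ∧ ¬ TransGen R v u := by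
  unfold relPos
  split_ifs <;> simp_all

/-- The order of the blocks in the `2`-uniform word attached to a vertex. -/
def blockPattern : List RelPos :=
  [.ancestor, .inNbr, .unrelated, .ancestor, .self, .outNbr, .inNbr, .self, .descendant,
    .unrelated, .outNbr, .descendant]

open Classical in
/-- Given a topological order `l`, a word in which every edge alternates, and in which `v`
alternates with its neighbours only. -/
noncomputable def vertexWord {V : Type*} (R : V → V → Prop) (l : List V) (v : V) : List V :=
  blockPattern.flatMap fun c => l.filter fun x => relPos R v x = c

open Classical in
theorem filter_vertexWord {V : Type*} (R : V → V → Prop) (l : List V) (v : V) (p : V → Bool) :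
    (vertexWord R l v).filter p =
      blockPattern.flatMap fun c => (l.filter p).filter fun x => relPos R v x = c := by
  simp only [vertexWord, List.filter_flatMap, List.filter_filter, Bool.and_comm]

theorem mem_vertexWord {V : Type*} (R : V → V → Prop) {l : List V} (v : V) {u : V} (hu : u ∈ l) :
    u ∈ vertexWord R l v := by
  simp only [vertexWord, List.mem_flatMap, List.mem_filter, hu, true_and, decide_eq_true_eq]
  exact ⟨relPos R v u, by cases relPos R v u <;> simp [blockPattern], rfl⟩

-- Each admissible pair of positions relative to `v` interleaves in `blockPattern`; two letters in
-- the same class are put in order by `l`. Semi-transitivity excludes the bad pairs, such as an arc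
-- from an ancestor to an out-neighbour.
open Classical in
theorem SemiTransitive.filter_vertexWord_of_rel {V : Type*} {R : V → V → Prop}
    (hR : SemiTransitive R) {l : List V} {a b : V} (hab : R a b)
    (hl : l.filter (fun x => x = a ∨ x = b) = [a, b]) (v : V) :
    (vertexWord R l v).filter (fun x => x = a ∨ x = b) = [a, b, a, b] := by
  have irr : ∀ a, ¬ R a a := fun a h => hR.acyclic a (.single h)
  have asym : ∀ a b, R a b → ¬ R b a := fun a b h h' => hR.acyclic a (.tail (.single h) h')
  have h1 : TransGen R a b := .single hab
  rw [filter_vertexWord, hl]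
  unfold blockPattern
  by_cases ha : a = v
  · subst ha
    have hb : relPos R a b = .outNbr := by
      have : b ≠ a := by rintro rfl; exact irr _ hab
      simp [relPos, this, hab, asym _ _ hab]
    have ha : relPos R a a = .self := by simp [relPos]
    simp [ha, hb]
  by_cases hb : b = v
  · subst hb
    have hb : relPos R b a = .inNbr := by simp [relPos, ha, hab]
    have ha : relPos R b b = .self := by simp [relPos]
    simp [ha, hb]
  have key : ∀ x y, ¬ (TransGen R x y ∧ TransGen R y x) :=
    fun x y h => hR.acyclic x (h.1.trans h.2)
  have hav : R a v → TransGen R a v := .single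
  have hva : R v a → TransGen R v a := .single
  have hbv : R b v → TransGen R b v := .single
  have hvb : R v b → TransGen R v b := .single
  have t1 : TransGen R b v → TransGen R a v := h1.trans
  have t2 : TransGen R v a → TransGen R v b := fun h => h.trans h1
  have s1 : TransGen R a v → TransGen R v b → R a v := hR.left hab
  have s2 : TransGen R a v → TransGen R v b → R v b := hR.right hab
  have s3 : R a v → TransGen R b v → R b v := fun h h' => hR.right h h1 h'
  have s4 : R v b → TransGen R v a → R v a := fun h h' => hR.left h h' h1
  have ka := key a v
  have kb := key b v
  rcases relPos_cases R ha with ⟨pa, _⟩ | ⟨pa, _⟩ | ⟨pa, _, _⟩ | ⟨pa, _, _⟩ | ⟨pa, _, _⟩ <;>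
  rcases relPos_cases R hb with ⟨pb, _⟩ | ⟨pb, _⟩ | ⟨pb, _, _⟩ | ⟨pb, _, _⟩ | ⟨pb, _, _⟩ <;>
  first | (exfalso; clear hl; grind only) | simp [pa, pb]

-- In `blockPattern` both ancestor blocks precede both `self` blocks, both descendant blocks follow
-- them, and the unrelated blocks enclose them, so `a` occurs twice in a row.
open Classical in
theorem not_isChain_filter_vertexWord {V : Type*} {R : V → V → Prop} {l : List V} {a b : V}
    (hne : b ≠ a) (hab : ¬ R a b) (hba : ¬ R b a)
    (hl : l.filter (fun x => x = a ∨ x = b) = [a, b] ∨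
      l.filter (fun x => x = a ∨ x = b) = [b, a]) :
    ¬ ((vertexWord R l a).filter (fun x => x = a ∨ x = b)).IsChain (· ≠ ·) := by
  have ha : relPos R a a = .self := by simp [relPos]
  rw [filter_vertexWord]
  unfold blockPattern
  have hb : relPos R a b = .ancestor ∨ relPos R a b = .descendant ∨
      relPos R a b = .unrelated := by
    simp only [relPos, hne, hab, hba, if_false]
    split_ifs <;> simp
  rcases hl with hl | hl <;> rcases hb with hb | hb | hb <;> rw [hl] <;> simp [ha, hb]

/-- A finite graph with a semi-transitive orientation is word-representable. -/
theorem SemiTransitive.wordRepresentable {V : Type*} [Finite V] {G : SimpleGraph V}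
    {R : V → V → Prop} (hR : SemiTransitive R) (hG : ∀ a b, G.Adj a b ↔ R a b ∨ R b a) :
    G.WordRepresentable := by
  classical
  obtain ⟨l, hmem, hpair, hsort⟩ := exists_topological_list hR.acyclic
  have hchain : ∀ a b, R a b → Alternate (l.flatMap (vertexWord R l)) a b := by
    intro a b hab
    have hne : a ≠ b := by rintro rfl; exact hR.acyclic a (.single hab)
    have : ∀ m : List V, (m.flatMap fun _ => [a, b, a, b]).IsChain (· ≠ ·) := by
      intro m
      induction m with
      | nil => simp
      | cons x m ih =>
        cases m with
        | nil => simp [hne, hne.symm]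
        | cons y m => simpa [hne, hne.symm] using ih
    unfold Alternate
    rw [List.filter_flatMap]
    simp only [hR.filter_vertexWord_of_rel hab (hsort a b hab)]
    exact this l
  refine ⟨l.flatMap (vertexWord R l), fun v => ?_, fun a b hab => ⟨fun h => ?_, fun h => ?_⟩⟩
  · exact List.mem_flatMap.2 ⟨v, hmem v, mem_vertexWord R v (hmem v)⟩
  · rcases (hG a b).1 h with h | h
    · exact hchain a b h
    · have := hchain b a h
      unfold Alternate at this ⊢
      simpa only [or_comm] using this
  · by_contra hn
    rw [hG, not_or] at hn
    refine not_isChain_filter_vertexWord hab.symm hn.1 hn.2 (hpair a b hab) ?_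
    unfold Alternate at h
    refine h.infix ?_
    exact (List.infix_flatMap_of_mem (hmem a) _).filter _

/-! ### Line graphs and increasing walks -/

/-- One step of an increasing walk: the dart `p` is continued by the dart `q`, whose end has a
larger label than the start of `p`. -/
def IncStep {V : Type*} (G : SimpleGraph V) (f : V → ℕ) (p q : V × V) : Prop :=
  p.2 = q.1 ∧ G.Adj p.1 p.2 ∧ G.Adj q.1 q.2 ∧ f p.1 < f q.2

/-- The orientation of the line graph in which the edges at each vertex are ordered by the
labels of their other endpoints. -/
def lineRel {V : Type*} (G : SimpleGraph V) (f : V → ℕ) (e e' : G.edgeSet) : Prop :=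
  ∃ x y z, (e : Sym2 V) = s(y, x) ∧ (e' : Sym2 V) = s(x, z) ∧ f y < f z

theorem lineGraph_adj_iff_lineRel {V : Type*} (G : SimpleGraph V) {f : V → ℕ}
    (hf : Function.Injective f) (e e' : G.edgeSet) :
    G.lineGraph.Adj e e' ↔ lineRel G f e e' ∨ lineRel G f e' e := by
  rw [SimpleGraph.lineGraph_adj_iff_exists]
  constructor
  · rintro ⟨hne, x, ⟨y, hy⟩, ⟨z, hz⟩⟩
    have hyz : f y ≠ f z := by
      intro h
      rw [hf h, ← hz] at hy
      exact hne (Subtype.ext hy)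
    rcases lt_or_gt_of_ne hyz with h | h
    · exact .inl ⟨x, y, z, hy.trans Sym2.eq_swap, hz, h⟩
    · exact .inr ⟨x, z, y, hz.trans Sym2.eq_swap, hy, h⟩
  · have key : ∀ e e', lineRel G f e e' →
        e ≠ e' ∧ ∃ v, v ∈ (e : Sym2 V) ∧ v ∈ (e' : Sym2 V) := by
      rintro e e' ⟨x, y, z, he, he', h⟩
      refine ⟨?_, x, by simp [he], by simp [he']⟩
      rintro rfl
      rw [he, Sym2.eq_swap, Sym2.congr_right] at he'
      exact h.ne (congrArg f he')
    rintro (h | h)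
    · exact key _ _ h
    · obtain ⟨hne, v, h1, h2⟩ := key _ _ h
      exact ⟨hne.symm, v, h2, h1⟩

/-- Consecutive arcs pivoting at the same vertex merge into one step, by transitivity of `<`. The
last step is kept apart so that its end can be replaced. -/
theorem exists_incStep_of_transGen_lineRel {V : Type*} {G : SimpleGraph V} {f : V → ℕ}
    {e e' : G.edgeSet} (h : TransGen (lineRel G f) e e') :
    ∃ p m q, (e : Sym2 V) = s(p.1, p.2) ∧ (e' : Sym2 V) = s(q.1, q.2) ∧
      ReflTransGen (IncStep G f) p m ∧ IncStep G f m q := by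
  have adj : ∀ (e : G.edgeSet) {x y}, (e : Sym2 V) = s(x, y) → G.Adj x y := by
    intro e x y h
    rw [← SimpleGraph.mem_edgeSet, ← h]
    exact e.2
  induction h with
  | single h =>
    obtain ⟨x, y, z, he, he', h⟩ := h
    exact ⟨(y, x), (y, x), (x, z), he, he', .refl, rfl, adj _ he, adj _ he', h⟩
  | tail _ h ih =>
    obtain ⟨x, y, z, he, he', h⟩ := h
    obtain ⟨p, m, ⟨c, d⟩, hp, hq, hpm, hmq⟩ := ih
    rw [hq, Sym2.eq_iff] at he
    rcases he with ⟨rfl, rfl⟩ | ⟨rfl, rfl⟩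
    · exact ⟨p, (c, d), (d, z), hp, he', hpm.tail hmq, rfl, hmq.2.2.1, adj _ he', h⟩
    · exact ⟨p, m, (c, z), hp, he', hpm, hmq.1, hmq.2.1, adj _ he', hmq.2.2.2.trans h⟩

theorem disjoint_of_incStep {V : Type*} {G : SimpleGraph V} {f : V → ℕ}
    (H : ∀ a b c, ¬ TransGen (IncStep G f) (a, b) (c, a)) {p p' q' q : V × V}
    (h₁ : IncStep G f p p') (h₂ : ReflTransGen (IncStep G f) p' q') (h₃ : IncStep G f q' q) :
    p.1 ≠ q.1 ∧ p.1 ≠ q.2 ∧ p.2 ≠ q.1 ∧ p.2 ≠ q.2 := by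
  have H' : ∀ {p q : V × V}, TransGen (IncStep G f) p q → p.1 ≠ q.2 := by
    rintro ⟨a, b⟩ ⟨c, d⟩ h rfl
    exact H _ _ _ h
  refine ⟨?_, H' ((TransGen.head' h₁ h₂).tail h₃), ?_, ?_⟩
  · rw [← h₃.1]
    exact H' (TransGen.head' h₁ h₂)
  · rw [← h₃.1, h₁.1]
    rcases reflTransGen_iff_eq_or_transGen.1 h₂ with rfl | h
    · exact h₁.2.2.1.ne
    · exact H' h
  · rw [h₁.1]
    exact H' (TransGen.tail' h₂ h₃)

/-- A shared endpoint of the first and last edges of a walk of at least two steps would make some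
subwalk return to its start. -/
theorem disjoint_of_transGen_incStep {V : Type*} {G : SimpleGraph V} {f : V → ℕ}
    (H : ∀ a b c, ¬ TransGen (IncStep G f) (a, b) (c, a)) {p m q : V × V}
    (h₁ : TransGen (IncStep G f) p m) (h₂ : TransGen (IncStep G f) m q) {x : V}
    (hp : x ∈ s(p.1, p.2)) (hq : x ∈ s(q.1, q.2)) : False := by
  obtain ⟨p', h, hp'⟩ := TransGen.head'_iff.1 h₁
  obtain ⟨q', hq', h'⟩ := TransGen.tail'_iff.1 h₂
  obtain ⟨h1, h2, h3, h4⟩ := disjoint_of_incStep H h (hp'.trans hq') h'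
  rw [Sym2.mem_iff] at hp hq
  rcases hp with rfl | rfl <;> rcases hq with hq | hq <;> contradiction

/-- If no increasing walk returns to its start, the orientation of the line graph is
semi-transitive. -/
theorem semiTransitive_lineRel {V : Type*} {G : SimpleGraph V} {f : V → ℕ}
    (H : ∀ a b c, ¬ TransGen (IncStep G f) (a, b) (c, a)) : SemiTransitive (lineRel G f) := by
  have key : ∀ {u v w}, lineRel G f u w → TransGen (lineRel G f) u v →
      TransGen (lineRel G f) v w → lineRel G f u v ∧ lineRel G f v w := by
    intro u v w huw huv hvw
    obtain ⟨x, y, z, hu, hw, -⟩ := huw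
    have hxu : x ∈ (u : Sym2 V) := by simp [hu]
    have hxw : x ∈ (w : Sym2 V) := by simp [hw]
    obtain ⟨p, m₁, ⟨c, d⟩, hp, hv, hpm, hm₁⟩ := exists_incStep_of_transGen_lineRel huv
    obtain ⟨⟨c', d'⟩, m₃, q, hv', hq, hm₃, hmq⟩ := exists_incStep_of_transGen_lineRel hvw
    rw [hp] at hxu
    rw [hq] at hxw
    obtain ⟨m₂, hm₂, hm₂q⟩ := TransGen.head'_iff.1 (TransGen.tail' hm₃ hmq)
    have hcd := hv.symm.trans hv'
    rw [Sym2.eq_iff] at hcd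
    rcases hcd with ⟨rfl, rfl⟩ | ⟨rfl, rfl⟩
    -- Both walks cross `v` in the same direction, so they concatenate.
    · exact (disjoint_of_transGen_incStep H (TransGen.tail' hpm hm₁)
        (TransGen.head' hm₂ hm₂q) hxu hxw).elim
    -- The walks cross `v` in opposite directions, so `v` can be skipped. Only a single step `m₁ →
    -- m₂` survives, and then all three edges meet at one vertex.
    · have hstep : IncStep G f m₁ m₂ :=
        ⟨hm₁.1.trans hm₂.1, hm₁.2.1, hm₂.2.2.1, hm₁.2.2.2.trans hm₂.2.2.2⟩
      rcases reflTransGen_iff_eq_or_transGen.1 hpm with rfl | hpm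
      · rcases reflTransGen_iff_eq_or_transGen.1 hm₂q with rfl | hm₂q
        · refine ⟨⟨c, m₁.1, d, ?_, hv, hm₁.2.2.2⟩, ⟨c, d, q.2, hv', ?_, hm₂.2.2.2⟩⟩
          · rw [hp, hm₁.1]
          · rw [hq, ← hm₂.1]
        · exact (disjoint_of_transGen_incStep H (.single hstep) hm₂q hxu hxw).elim
      · exact (disjoint_of_transGen_incStep H hpm (.head' hstep hm₂q) hxu hxw).elim
  refine ⟨fun e h => ?_, fun h h₁ h₂ => (key h h₁ h₂).1, fun h h₁ h₂ => (key h h₁ h₂).2⟩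
  obtain ⟨p, m, q, hp, hq, hpm, hmq⟩ := exists_incStep_of_transGen_lineRel h
  rcases reflTransGen_iff_eq_or_transGen.1 hpm with rfl | hpm
  · rw [hp, ← hmq.1, Sym2.eq_swap, Sym2.congr_right] at hq
    exact hmq.2.2.2.ne (congrArg f hq)
  · have hx : q.1 ∈ s(p.1, p.2) := by rw [← hp, hq]; simp
    exact disjoint_of_transGen_incStep H hpm (.single hmq) hx (by simp)

theorem lineGraph_wordRepresentable_of_label {V : Type*} [Finite V] {G : SimpleGraph V}
    {f : V → ℕ} (hf : Function.Injective f)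
    (H : ∀ a b c, ¬ TransGen (IncStep G f) (a, b) (c, a)) : G.lineGraph.WordRepresentable :=
  (semiTransitive_lineRel H).wordRepresentable (lineGraph_adj_iff_lineRel G hf)

/-- Every second vertex of the walk has a larger label; the two alternatives are an even and an odd
number of steps. -/
theorem le_of_incStep {V : Type*} {G : SimpleGraph V} {f : V → ℕ} {p q : V × V}
    (h : ReflTransGen (IncStep G f) p q) :
    f p.1 ≤ f q.1 ∧ f p.2 ≤ f q.2 ∨ f p.1 < f q.2 ∧ f p.2 ≤ f q.1 := by
  induction h with
  | refl => simp
  | tail _ h ih =>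
    obtain ⟨h1, -, -, h2⟩ := h
    rw [← h1]
    omega

/-! ### The labelling of the Mycielski graph -/

instance MycielskiVertex.instFinite {V : Type*} [Finite V] : Finite (MycielskiVertex V) :=
  Finite.of_surjective
    (fun x : Option (V ⊕ V) => match x with
      | none => MycielskiVertex.apex
      | some (.inl v) => .orig v
      | some (.inr v) => .copy v)
    (by
      rintro (v | v | _)
      · exact ⟨some (.inl v), rfl⟩
      · exact ⟨some (.inr v), rfl⟩
      · exact ⟨none, rfl⟩)

/-- A labelling of the vertices of the Mycielski graph of an odd cycle: vertices are ordered by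
their index, a copy precedes its original except at the last index, and the apex comes last. -/
def mycielskiLabel (n : ℕ) : MycielskiVertex (Fin (2 * n + 1)) → ℕ
  | .orig i => if i.val = 2 * n then 4 * n else 2 * i.val + 1
  | .copy i => if i.val = 2 * n then 4 * n + 1 else 2 * i.val
  | .apex => 4 * n + 2

theorem mycielskiLabel_injective (n : ℕ) : Function.Injective (mycielskiLabel n) := by
  rintro (i | i | _) (j | j | _) h <;> simp only [mycielskiLabel] at h <;>
    simp only [MycielskiVertex.orig.injEq, MycielskiVertex.copy.injEq, reduceCtorEq,
      Fin.ext_iff] <;> split_ifs at h <;> omega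

theorem mycielskiLabel_le (n : ℕ) (v : MycielskiVertex (Fin (2 * n + 1))) :
    mycielskiLabel n v ≤ 4 * n + 2 := by
  rcases v with i | i | _ <;> simp only [mycielskiLabel] <;> (try split_ifs) <;> omega

theorem cycleGraph_adj_val {n : ℕ} {i j : Fin (2 * n + 1)}
    (h : (SimpleGraph.cycleGraph (2 * n + 1)).Adj i j) :
    i.val + 1 = j.val ∨ j.val + 1 = i.val ∨ i.val = 0 ∧ j.val = 2 * n ∨
      i.val = 2 * n ∧ j.val = 0 := by
  rw [SimpleGraph.cycleGraph_adj'] at h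
  have key : ∀ i j : Fin (2 * n + 1), (i - j).val = 1 →
      j.val + 1 = i.val ∨ i.val = 0 ∧ j.val = 2 * n := by
    intro i j h
    rcases le_or_gt j i with hij | hij
    · rw [Fin.sub_val_of_le hij] at h
      omega
    · rw [Fin.coe_sub_iff_lt.2 hij] at h
      have := Fin.lt_def.1 hij
      omega
  rcases h with h | h
  · have := key i j h
    omega
  · have := key j i h
    omega

/-- Half the label is the index of a vertex, so adjacency away from the apex is adjacency of
the half labels in the cycle. -/
theorem mycielski_adj_label {n : ℕ} {u v : MycielskiVertex (Fin (2 * n + 1))}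
    (h : (SimpleGraph.cycleGraph (2 * n + 1)).mycielski.Adj u v)
    (hu : mycielskiLabel n u < 4 * n + 2) (hv : mycielskiLabel n v < 4 * n + 2) :
    mycielskiLabel n u / 2 + 1 = mycielskiLabel n v / 2 ∨
      mycielskiLabel n v / 2 + 1 = mycielskiLabel n u / 2 ∨
      mycielskiLabel n u / 2 = 0 ∧ mycielskiLabel n v / 2 = 2 * n ∨
      mycielskiLabel n u / 2 = 2 * n ∧ mycielskiLabel n v / 2 = 0 := by
  rcases u with i | i | _ <;> rcases v with j | j | _ <;>
    simp only [SimpleGraph.mycielski] at h <;> simp only [mycielskiLabel] at hu hv ⊢ <;>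
    first
    | omega
    | (have := cycleGraph_adj_val h
       split_ifs <;> omega)

theorem eq_apex_of_label {n : ℕ} {v : MycielskiVertex (Fin (2 * n + 1))}
    (h : 4 * n + 2 ≤ mycielskiLabel n v) : v = .apex :=
  mycielskiLabel_injective n (le_antisymm (mycielskiLabel_le n v) h)

/-- An increasing walk avoiding the apex does not return to its start. -/
theorem not_return_of_ne_apex {n : ℕ} (hn : 2 ≤ n) {a b c : MycielskiVertex (Fin (2 * n + 1))}
    (h : TransGen (IncStep (SimpleGraph.cycleGraph (2 * n + 1)).mycielski (mycielskiLabel n))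
      (a, b) (c, a)) (hc : mycielskiLabel n c < 4 * n + 2) : False := by
  obtain ⟨q, hq, hqc⟩ := TransGen.tail'_iff.1 h
  obtain ⟨p, hp, hpc⟩ := TransGen.head'_iff.1 h
  have hab := hp.2.1
  have hca := hqc.2.2.1
  have h1 := le_of_incStep hpc
  have h2 := le_of_incStep hq
  have h3 := hp.2.2.2
  have h4 := hqc.2.2.2
  have h5 := hp.1
  have h6 := hqc.1
  dsimp only at hab hca h1 h2 h3 h4 h5 h6
  rw [← h5] at h1
  rw [h6] at h2
  have hab0 : mycielskiLabel n a ≠ mycielskiLabel n b :=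
    fun h => hab.ne (mycielskiLabel_injective n h)
  have hca0 : mycielskiLabel n c ≠ mycielskiLabel n a :=
    fun h => hca.ne (mycielskiLabel_injective n h)
  have A1 := mycielski_adj_label hab (by omega) (by omega)
  have A2 := mycielski_adj_label hca (by omega) (by omega)
  -- The label bounds force f b < f a < f c, and wrapping around the cycle cannot satisfy both
  -- adjacencies.
  have hb : mycielskiLabel n b / 2 + 1 = mycielskiLabel n a / 2 := by omega
  have hc' : mycielskiLabel n a / 2 + 1 = mycielskiLabel n c / 2 := by omega
  -- Trap: the walk bounces between the indices of `a` and `b`, so it never reaches the index of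
  -- `c`.
  have key : ∀ p, ReflTransGen (IncStep (SimpleGraph.cycleGraph (2 * n + 1)).mycielski
      (mycielskiLabel n)) p (c, a) →
      ¬ (mycielskiLabel n p.1 / 2 = mycielskiLabel n a / 2 ∧
        mycielskiLabel n p.2 / 2 = mycielskiLabel n b / 2 ∧
        mycielskiLabel n a ≤ mycielskiLabel n p.1) ∧
      ¬ (mycielskiLabel n p.1 / 2 = mycielskiLabel n b / 2 ∧
        mycielskiLabel n p.2 / 2 = mycielskiLabel n a / 2 ∧
        mycielskiLabel n a < mycielskiLabel n p.2) := by
    intro p hp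
    induction hp using ReflTransGen.head_induction_on with
    | refl => dsimp only; omega
    | @head p r hpr hr ih =>
      have b1 := le_of_incStep hr
      obtain ⟨e, -, hadj, hlt⟩ := hpr
      rw [e] at *
      dsimp only at b1
      constructor
      · rintro ⟨i1, i2, i3⟩
        -- By `b1` the next index is at most that of `c`; `2 ≤ n` rules out a jump from index 0 to
        -- 2n.
        have := mycielski_adj_label hadj (by omega) (by omega)
        exact ih.2 ⟨by omega, by omega, by omega⟩
      · rintro ⟨i1, i2, i3⟩
        have := mycielski_adj_label hadj (by omega) (by omega)
        exact ih.1 ⟨by omega, by omega, by omega⟩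
  exact (key _ h.to_reflTransGen).1 ⟨rfl, rfl, le_rfl⟩

/-- An increasing walk through the apex does not return to its start. -/
theorem not_return_apex {n : ℕ} (hn : 2 ≤ n) {a b : MycielskiVertex (Fin (2 * n + 1))}
    (h : TransGen (IncStep (SimpleGraph.cycleGraph (2 * n + 1)).mycielski (mycielskiLabel n))
      (a, b) (.apex, a)) : False := by
  have haa : (SimpleGraph.cycleGraph (2 * n + 1)).mycielski.Adj .apex a := by
    obtain ⟨q, -, hq⟩ := TransGen.tail'_iff.1 h
    exact hq.2.2.1
  obtain ⟨⟨b', c⟩, h1, h⟩ := TransGen.head'_iff.1 h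
  obtain ⟨rfl, hab, hbc, hac⟩ := h1
  dsimp only at hab hbc hac
  rcases h.cases_head with h | ⟨⟨c', d⟩, h2, h⟩
  · simp only [Prod.mk.injEq] at h
    rw [h.2] at hac
    exact hac.false
  obtain ⟨rfl, -, hcd, hbd⟩ := h2
  dsimp only at hcd hbd
  rcases h.cases_head with h | ⟨⟨d', e⟩, h3, h⟩
  · simp only [Prod.mk.injEq] at h
    obtain ⟨rfl, rfl⟩ := h
    -- The apex lies in no triangle, since copies are pairwise nonadjacent.
    rcases d with i | i | _ <;> rcases b with j | j | _ <;>
      simp only [SimpleGraph.mycielski] at hab hbc hcd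
  obtain ⟨rfl, -, hde, hce⟩ := h3
  have hb := le_of_incStep h
  dsimp only at hb hce
  have hda : mycielskiLabel n d < mycielskiLabel n a := by omega
  have hd := mycielskiLabel_le n d
  have ha := mycielskiLabel_le n a
  have hcd' := mycielski_adj_label hcd
  have hbc' := mycielski_adj_label hbc
  have hab' := mycielski_adj_label hab
  clear h hb hde hce
  generalize mycielskiLabel n d = x at *
  -- Here f b < x < f a < f c, with `a` a copy and `b` an original. Below the last index, f b and f
  -- a are consecutive, leaving no room for x. At the last index f a = 4n + 1, thanks to the swapped
  -- labels, so only the apex could be `c`, but it is not adjacent to `b`.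
  rcases a with i | i | _ <;> try (simp only [SimpleGraph.mycielski] at haa; done)
  rcases b with j | j | _ <;> try (simp only [SimpleGraph.mycielski] at hab; done)
  · rcases c with k | k | _ <;> try (simp only [SimpleGraph.mycielski] at hbc; done)
    all_goals
      simp only [mycielskiLabel] at *
      split_ifs at * <;> omega
  · simp only [mycielskiLabel] at hbd
    omega

theorem mainTheorem1 (n : ℕ) (hn : 2 ≤ n) :
    (SimpleGraph.cycleGraph (2 * n + 1)).mycielski.lineGraph.WordRepresentable := by
  refine lineGraph_wordRepresentable_of_label (mycielskiLabel_injective n) fun a b c h => ?_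
  rcases lt_or_ge (mycielskiLabel n c) (4 * n + 2) with hc | hc
  · exact not_return_of_ne_apex hn h hc
  · obtain rfl := eq_apex_of_label hc
    exact not_return_apex hn h
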